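/- Let $d\ge 0$ and $k\ge 0$ be integers with $d\ge 2$ or $k=0$. Let $W$ be the universal Coxeter group with Coxeter generators $s_1,\ldots,s_{d+1}$, i.e. $m(s_i,s_j)=\infty$ for all $i\ne j$, ordered by the Bruhat order: $v\le w$ if and only if some reduced word for $w$ has a (not necessarily consecutive) subword that is a reduced word for $v$. For $m\ge 0$ let $C_m\in W$ be the element $s_1s_2\cdots s_m$, where the subscripts are read modulo $d+1$. Then the Bruhat interval $[C_k,C_{d+k+1}]=\{w\in W : C_k\le w\le C_{d+k+1}\}$ is isomorphic, as a poset, to the face lattice of a dual stacked polytope of dimension $d$ with exactly $d+k+1$ facets. Here the face lattice of a polytope $P$ is the set of its faces (including $\emptyset$ and $P$) ordered by inclusion, a facet is a face of dimension $\dim P-1$ (where $\dim\emptyset=-1$), and a polytope is dual stacked if it can be obtained from a simplex by a finite (possibly empty) series of vertex shavings. A shaving of $P$ at a vertex $v$ is $P\cap\{x : a\cdot x\le b\}$, where the hyperplane $\{x: a\cdot x=b\}$ separates $v$ from the other vertices: $a\cdot v>b$ and $a\cdot v'<b$ for all vertices $v'\ne v$ of $P$. -/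

import Mathlib

/-- The universal Coxeter matrix on `B`: `m(s,s) = 1`, and `m(s,t) = ∞` for `s ≠ t`
(Mathlib encodes `∞` as the entry `0`, for which the relation `(st)^0 = 1` is trivial). -/
def universalCoxeterMatrix (B : Type*) [DecidableEq B] : CoxeterMatrix B where
  M := Matrix.of fun i j => if i = j then 1 else 0
  isSymm := by
    ext i j
    simp [eq_comm]
  diagonal := by simp
  off_diagonal := by
    intro i j h
    simp [h]

namespace CoxeterSystem

variable {B W : Type*} [Group W] {M : CoxeterMatrix B}

/-- Bruhat order, by the subword property: `v ≤ w` when some reduced word for `w` has a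
subword (not necessarily consecutive) that is a reduced word for `v`. -/
def BruhatLE (cs : CoxeterSystem M W) (v w : W) : Prop :=
  ∃ ω : List B, cs.IsReduced ω ∧ cs.wordProd ω = w ∧
    ∃ ω' : List B, ω'.Sublist ω ∧ cs.IsReduced ω' ∧ cs.wordProd ω' = v

/-- The Bruhat interval `[u, v]`. -/
def BruhatInterval (cs : CoxeterSystem M W) (u v : W) : Type _ :=
  {w : W // cs.BruhatLE u w ∧ cs.BruhatLE w v}

/-- A Bruhat interval is ordered by the Bruhat order. -/
instance (cs : CoxeterSystem M W) (u v : W) : LE (cs.BruhatInterval u v) :=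
  ⟨fun x y => cs.BruhatLE x.1 y.1⟩

end CoxeterSystem

/-- The cyclic word of length `k` in `d + 1` letters `0, 1, …, d`, starting with the letter `0`. -/
def cyclicWord (d k : ℕ) : List (Fin (d + 1)) :=
  (List.range k).map (Fin.ofNat (d + 1))

namespace ConvexPolytope

variable {n : ℕ}

/-- The dimension of a set `P ⊆ ℝⁿ`: the dimension of its affine span, which is `-1` if `P` is
empty. -/
noncomputable def dim (P : Set (EuclideanSpace ℝ (Fin n))) : ℤ :=
  open Classical in if P = ∅ then -1 else (Module.finrank ℝ (vectorSpan ℝ P) : ℤ)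

/-- `F` is a face of `P`: it is the empty set, or `P` itself, or the intersection of `P` with a
supporting hyperplane `{x | a ⬝ x = b}`. -/
def IsFace (P F : Set (EuclideanSpace ℝ (Fin n))) : Prop :=
  F = ∅ ∨ F = P ∨
    ∃ (a : EuclideanSpace ℝ (Fin n)) (b : ℝ), a ≠ 0 ∧
      ((∀ x ∈ P, inner ℝ a x ≤ b) ∨ (∀ x ∈ P, b ≤ inner ℝ a x)) ∧
      F = P ∩ {x | inner ℝ a x = b}

/-- The face lattice of `P`, ordered by inclusion (the order of a subtype of `Set`). -/
abbrev FaceLattice (P : Set (EuclideanSpace ℝ (Fin n))) : Type :=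
  {F : Set (EuclideanSpace ℝ (Fin n)) // IsFace P F}

/-- The set of facets of `P`: the faces of dimension one less than that of `P`. -/
def facets (P : Set (EuclideanSpace ℝ (Fin n))) : Set (Set (EuclideanSpace ℝ (Fin n))) :=
  {F | IsFace P F ∧ dim F = dim P - 1}

/-- `v` is a vertex of `P`: `{v}` is a face of `P`. -/
def IsVertex (P : Set (EuclideanSpace ℝ (Fin n))) (v : EuclideanSpace ℝ (Fin n)) : Prop :=
  IsFace P {v}

/-- `Q` is obtained from `P` by shaving off a vertex `v`, that is, by cutting `P` along a hyperplane
that strictly separates `v` from all the other vertices of `P`. -/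
def IsVertexShaving (P Q : Set (EuclideanSpace ℝ (Fin n))) : Prop :=
  ∃ v : EuclideanSpace ℝ (Fin n), IsVertex P v ∧
    ∃ (a : EuclideanSpace ℝ (Fin n)) (b : ℝ),
      b < inner ℝ a v ∧ (∀ v', IsVertex P v' → v' ≠ v → inner ℝ a v' < b) ∧
      Q = P ∩ {x | inner ℝ a x ≤ b}

/-- Dual stacked polytopes: those obtained from a simplex by a finite (possibly empty) series of
vertex shavings. -/
inductive IsDualStacked : Set (EuclideanSpace ℝ (Fin n)) → Prop
  | simplex {m : ℕ} (s : Affine.Simplex ℝ (EuclideanSpace ℝ (Fin n)) m) :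
      IsDualStacked (convexHull ℝ (Set.range s.points))
  | shave {P Q : Set (EuclideanSpace ℝ (Fin n))} :
      IsDualStacked P → IsVertexShaving P Q → IsDualStacked Q

end ConvexPolytope

/-! In the universal Coxeter group every element has exactly one reduced word, and the reduced words
are those without equal adjacent letters. Bruhat order is therefore the subword order
(`bruhatLE_wordProd_iff`), and an element below `C_N`, `N = d + k + 1`, is the cyclic word of length
`N` with a set `D` of positions deleted.

When `|D| ≤ d` the word determines `D`, since two possible positions of the same letter differ by
less than the period `d + 1`. The word contains `C_k` iff `D` lies in a window `{i, …, i + d}` with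
`i ≤ k`; deleting a full window leaves `C_k` itself. It is reduced iff `D` is not a wall `{i + 1, …,
i + d}` with `i < k`. So the interval without its minimum is `stackedComplex d k` with reversed
inclusion.

On the geometric side, the nonempty faces of a polyhedron given by inequalities correspond, with
reversed inclusion, to the active sets of its points (`nonempty_orderIso_faceLattice`). For a
simplex these are the proper subsets of `{0, …, d}`. Shaving the vertex with active set `V` removes
`V` and adds the new index to every proper subset of `V` (`exists_shaving`). With `V` the wall `{k +
1, …, k + d}`, this is the passage from `stackedComplex d k` to `stackedComplex d (k + 1)`
(`stackedComplex_succ`). The minimum `C_k` matches the empty face. -/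

namespace CoxeterSystem

/-! ### Reduced words and Bruhat order in the universal Coxeter group -/

section UniversalCoxeterGroup

variable {B W : Type*} [DecidableEq B] [Group W]

/-- Left multiplication by the letter `i` on the words without equal adjacent letters. -/
def chainMul (i : B) (l : {l : List B // l.IsChain (· ≠ ·)}) :
    {l : List B // l.IsChain (· ≠ ·)} :=
  if h : l.1.head? = some i then ⟨l.1.tail, l.2.tail⟩
  else ⟨i :: l.1, List.isChain_cons.2 ⟨fun y hy hiy => h (by rw [hiy]; exact hy), l.2⟩⟩

lemma chainMul_chainMul (i : B) (l : {l : List B // l.IsChain (· ≠ ·)}) :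
    chainMul i (chainMul i l) = l := by
  obtain ⟨l, hl⟩ := l
  by_cases h : l.head? = some i
  · cases l with
    | nil => simp at h
    | cons a t =>
      simp only [List.head?_cons, Option.some.injEq] at h
      subst h
      have ht : ¬ t.head? = some a := fun h' => (List.isChain_cons.1 hl).1 a h' rfl
      simp [chainMul, ht]
  · simp [chainMul, h]

/-- `chainMul i` as a permutation. -/
def chainPerm (i : B) : Equiv.Perm {l : List B // l.IsChain (· ≠ ·)} where
  toFun := chainMul i
  invFun := chainMul i
  left_inv := chainMul_chainMul i
  right_inv := chainMul_chainMul i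

lemma isLiftable_chainPerm :
    (universalCoxeterMatrix B).IsLiftable (chainPerm (B := B)) := by
  intro i j
  by_cases h : i = j
  · subst h
    ext1 l
    simp [universalCoxeterMatrix, chainPerm, chainMul_chainMul]
  · simp [universalCoxeterMatrix, h]

variable (cs : CoxeterSystem (universalCoxeterMatrix B) W)

/-- The group acts on words without equal adjacent letters, and acting on the empty word reads off
the normal form; this gives uniqueness of such words. -/
lemma lift_wordProd_nil {ω : List B} (hω : ω.IsChain (· ≠ ·)) :
    (cs.lift ⟨chainPerm, isLiftable_chainPerm⟩ (cs.wordProd ω) ⟨[], .nil⟩).1 = ω := by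
  induction ω with
  | nil => simp
  | cons i t ih =>
    have ht := ih hω.tail
    have hi : ¬ t.head? = some i := fun h' => (List.isChain_cons.1 hω).1 i h' rfl
    rw [wordProd_cons, map_mul, Equiv.Perm.mul_apply, lift_apply_simple]
    simp [chainPerm, chainMul, ht, hi]

lemma eq_of_wordProd_eq_of_isChain {ω ω' : List B} (hω : ω.IsChain (· ≠ ·))
    (hω' : ω'.IsChain (· ≠ ·)) (h : cs.wordProd ω = cs.wordProd ω') : ω = ω' := by
  rw [← cs.lift_wordProd_nil hω, ← cs.lift_wordProd_nil hω', h]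

lemma IsReduced.isChain {cs : CoxeterSystem (universalCoxeterMatrix B) W} {ω : List B}
    (h : cs.IsReduced ω) : ω.IsChain (· ≠ ·) := by
  rw [List.isChain_iff_forall_rel_of_append_cons_cons]
  rintro a b l₁ l₂ rfl rfl
  have h1 : cs.wordProd (l₁ ++ a :: a :: l₂) = cs.wordProd (l₁ ++ l₂) := by
    simp [wordProd_append, wordProd_cons]
  have h2 := cs.length_wordProd_le (l₁ ++ l₂)
  rw [IsReduced, h1] at h
  simp at h h2
  omega

lemma isReduced_iff_isChain {ω : List B} : cs.IsReduced ω ↔ ω.IsChain (· ≠ ·) := by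
  refine ⟨IsReduced.isChain, fun h => ?_⟩
  obtain ⟨ω', h1, h2⟩ := cs.exists_isReduced (cs.wordProd ω)
  rwa [cs.eq_of_wordProd_eq_of_isChain h h1.isChain h2]

lemma bruhatLE_wordProd_iff {ω ω' : List B} (hω : ω.IsChain (· ≠ ·))
    (hω' : ω'.IsChain (· ≠ ·)) :
    cs.BruhatLE (cs.wordProd ω) (cs.wordProd ω') ↔ ω.Sublist ω' := by
  constructor
  · rintro ⟨l', hl', h', l, hs, hl, h⟩
    rwa [← cs.eq_of_wordProd_eq_of_isChain hl.isChain hω h,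
      ← cs.eq_of_wordProd_eq_of_isChain hl'.isChain hω' h']
  · intro h
    exact ⟨ω', cs.isReduced_iff_isChain.2 hω', rfl, ω, h, cs.isReduced_iff_isChain.2 hω, rfl⟩

end UniversalCoxeterGroup

end CoxeterSystem

/-! ### Faces of a polyhedron and active sets -/

namespace ConvexPolytope

section Polyhedron

open AffineMap Filter Topology

variable {n : ℕ}

/-- The polyhedron cut out by the inequalities `0 ≤ s i` for `i < N`. -/
def polyhedron (N : ℕ) (s : ℕ → EuclideanSpace ℝ (Fin n) →ᵃ[ℝ] ℝ) :
    Set (EuclideanSpace ℝ (Fin n)) :=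
  {x | ∀ i < N, 0 ≤ s i x}

open Classical in
/-- The indices of the inequalities that are equalities at `x`. -/
noncomputable def activeSet (N : ℕ) (s : ℕ → EuclideanSpace ℝ (Fin n) →ᵃ[ℝ] ℝ)
    (x : EuclideanSpace ℝ (Fin n)) : Finset ℕ :=
  (Finset.range N).filter fun i => s i x = 0

/-- The active sets of the points of a polyhedron. -/
def activeSets (N : ℕ) (s : ℕ → EuclideanSpace ℝ (Fin n) →ᵃ[ℝ] ℝ) : Set (Finset ℕ) :=
  activeSet N s '' polyhedron N s

/-- The part of a polyhedron on which the inequalities in `D` are equalities. -/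
def faceOf (N : ℕ) (s : ℕ → EuclideanSpace ℝ (Fin n) →ᵃ[ℝ] ℝ) (D : Finset ℕ) :
    Set (EuclideanSpace ℝ (Fin n)) :=
  {x | x ∈ polyhedron N s ∧ ∀ i ∈ D, s i x = 0}

variable {N : ℕ} {s : ℕ → EuclideanSpace ℝ (Fin n) →ᵃ[ℝ] ℝ}

lemma mem_activeSet {x : EuclideanSpace ℝ (Fin n)} {i : ℕ} :
    i ∈ activeSet N s x ↔ i < N ∧ s i x = 0 := by
  simp [activeSet]

lemma activeSet_subset_range (x : EuclideanSpace ℝ (Fin n)) :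
    activeSet N s x ⊆ Finset.range N :=
  Finset.filter_subset _ _

lemma finite_activeSets : (activeSets N s).Finite := by
  refine (Finset.range N).powerset.finite_toSet.subset ?_
  rintro _ ⟨x, -, rfl⟩
  exact Finset.mem_coe.2 (Finset.mem_powerset.2 (activeSet_subset_range x))

lemma mem_faceOf_activeSet {x : EuclideanSpace ℝ (Fin n)} (hx : x ∈ polyhedron N s) :
    x ∈ faceOf N s (activeSet N s x) :=
  ⟨hx, fun _ hi => (mem_activeSet.1 hi).2⟩

lemma faceOf_activeSet_subset_iff {x : EuclideanSpace ℝ (Fin n)} (hx : x ∈ polyhedron N s)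
    {D : Finset ℕ} (hD : D ⊆ Finset.range N) :
    faceOf N s (activeSet N s x) ⊆ faceOf N s D ↔ D ⊆ activeSet N s x := by
  constructor
  · intro h i hi
    exact mem_activeSet.2 ⟨Finset.mem_range.1 (hD hi), (h (mem_faceOf_activeSet hx)).2 i hi⟩
  · intro h y hy
    exact ⟨hy.1, fun i hi => hy.2 i (h hi)⟩

lemma apply_lineMap_eq (f : EuclideanSpace ℝ (Fin n) →ᵃ[ℝ] ℝ) (x y : EuclideanSpace ℝ (Fin n))
    (t : ℝ) : f (lineMap x y t) = (1 - t) * f x + t * f y := by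
  rw [AffineMap.apply_lineMap, AffineMap.lineMap_apply_module]; simp

lemma sum_affineMap_apply (D : Finset ℕ) (x : EuclideanSpace ℝ (Fin n)) :
    (∑ i ∈ D, s i) x = ∑ i ∈ D, s i x := by
  induction D using Finset.induction_on with
  | empty => simp
  | insert i D hi ih => simp [Finset.sum_insert hi, ih]

lemma exists_inner_rep (f : EuclideanSpace ℝ (Fin n) →ᵃ[ℝ] ℝ) :
    ∃ (a : EuclideanSpace ℝ (Fin n)) (c : ℝ), ∀ x, f x = c + inner ℝ a x := by
  refine ⟨(InnerProductSpace.toDual ℝ _).symm (LinearMap.toContinuousLinearMap f.linear), f 0,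
    fun x => ?_⟩
  rw [InnerProductSpace.toDual_symm_apply]
  have := congrFun f.decomp x
  simp at this
  simp [this, add_comm]

/-- Active inequalities stay equalities along the whole line, and the strict ones survive for small
`t` by continuity. Both signs of `t` are allowed, so the segment may be prolonged beyond `x`. -/
lemma eventually_lineMap_mem_polyhedron {x y : EuclideanSpace ℝ (Fin n)}
    (hx : x ∈ polyhedron N s) (hy : ∀ i ∈ activeSet N s x, s i y = 0) :
    ∀ᶠ t : ℝ in 𝓝 0, lineMap x y t ∈ polyhedron N s := by
  have : ∀ i ∈ Set.Iio N, ∀ᶠ t : ℝ in 𝓝 0, 0 ≤ s i (lineMap x y t) := by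
    intro i hi
    simp only [apply_lineMap_eq]
    by_cases h : s i x = 0
    · simp [h, hy i (mem_activeSet.2 ⟨hi, h⟩)]
    · have hpos : 0 < s i x := lt_of_le_of_ne (hx i hi) (Ne.symm h)
      have hc : Continuous fun t : ℝ => (1 - t) * s i x + t * s i y := by fun_prop
      have h0 : Tendsto (fun t : ℝ => (1 - t) * s i x + t * s i y) (𝓝 0) (𝓝 (s i x)) := by
        simpa using hc.tendsto 0
      exact (h0.eventually (lt_mem_nhds hpos)).mono fun t ht => ht.le
  exact (eventually_all_finite (Set.finite_Iio N)).2 this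

/-- Such an `x` plays the role of a relative interior point. An inequality active at a midpoint is
active at both ends, so minimal cardinality forces minimality for inclusion. -/
lemma exists_minimal_activeSet {F : Set (EuclideanSpace ℝ (Fin n))} (hF : Convex ℝ F)
    (hFP : F ⊆ polyhedron N s) (hne : F.Nonempty) :
    ∃ x ∈ F, ∀ y ∈ F, activeSet N s x ⊆ activeSet N s y := by
  obtain ⟨x, hx, hmin⟩ := (measure fun x => (activeSet N s x).card).wf.has_min F hne
  refine ⟨x, hx, fun y hy => ?_⟩
  have hz : lineMap x y (1 / 2 : ℝ) ∈ F :=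
    hF.segment_subset hx hy (lineMap_mem_segment ℝ x y (by norm_num))
  have hsub : ∀ i ∈ activeSet N s (lineMap x y (1 / 2 : ℝ)), s i x = 0 ∧ s i y = 0 := by
    intro i hi
    obtain ⟨hiN, hi⟩ := mem_activeSet.1 hi
    rw [apply_lineMap_eq] at hi
    have h1 := hFP hx i hiN
    have h2 := hFP hy i hiN
    constructor <;> linarith
  have hle : activeSet N s (lineMap x y (1 / 2 : ℝ)) ⊆ activeSet N s x := fun i hi =>
    mem_activeSet.2 ⟨(mem_activeSet.1 hi).1, (hsub i hi).1⟩
  have heq := Finset.eq_of_subset_of_card_le hle (not_lt.1 (hmin _ hz))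
  intro i hi
  rw [← heq] at hi
  exact mem_activeSet.2 ⟨(mem_activeSet.1 hi).1, (hsub i hi).2⟩

lemma convex_polyhedron : Convex ℝ (polyhedron N s) := by
  have : polyhedron N s = ⋂ i ∈ Set.Iio N, s i ⁻¹' Set.Ici 0 := by
    ext x; simp [polyhedron]
  rw [this]
  exact convex_iInter₂ fun i _ => (convex_Ici 0).affine_preimage _

/-- The zero set in a polyhedron of a nonnegative affine function is cut out by its active
inequalities. -/
lemma exists_eq_faceOf_of_nonneg {F : Set (EuclideanSpace ℝ (Fin n))}
    (f : EuclideanSpace ℝ (Fin n) →ᵃ[ℝ] ℝ)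
    (hf : ∀ x ∈ polyhedron N s, 0 ≤ f x) (hF : F = polyhedron N s ∩ {x | f x = 0})
    (hne : F.Nonempty) : ∃ x ∈ polyhedron N s, F = faceOf N s (activeSet N s x) := by
  have hconv : Convex ℝ F := by
    rw [hF]
    exact convex_polyhedron.inter ((convex_singleton (0 : ℝ)).affine_preimage f)
  have hFP : F ⊆ polyhedron N s := hF ▸ Set.inter_subset_left
  obtain ⟨x, hx, hmin⟩ := exists_minimal_activeSet hconv hFP hne
  refine ⟨x, hFP hx, Set.Subset.antisymm (fun y hy => ⟨hFP hy, fun i hi =>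
    (mem_activeSet.1 (hmin y hy hi)).2⟩) fun y hy => ?_⟩
  -- Prolong the segment from `y` slightly beyond `x`, to some `t < 0`: as `f x = 0`, nonnegativity
  -- of `f` there forces `f y ≤ 0`.
  have hev := (eventually_lineMap_mem_polyhedron (hFP hx) hy.2).filter_mono
    (nhdsWithin_le_nhds (s := Set.Iio 0))
  obtain ⟨t, ht, ht0⟩ := (hev.and self_mem_nhdsWithin).exists
  have h1 := hf _ ht
  have hx0 : f x = 0 := (hF ▸ hx : x ∈ polyhedron N s ∩ {x | f x = 0}).2
  rw [apply_lineMap_eq, hx0] at h1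
  have h2 := hf y hy.1
  have ht0 : t < 0 := ht0
  rw [hF]
  exact ⟨hy.1, by show f y = 0; nlinarith⟩

lemma IsFace.exists_eq_faceOf {F : Set (EuclideanSpace ℝ (Fin n))}
    (h : IsFace (polyhedron N s) F) (hne : F.Nonempty) :
    ∃ x ∈ polyhedron N s, F = faceOf N s (activeSet N s x) := by
  rcases h with h | h | ⟨a, b, -, h | h, hF⟩
  · exact absurd h hne.ne_empty
  · exact exists_eq_faceOf_of_nonneg 0 (by simp) (by simp [h]) hne
  · refine exists_eq_faceOf_of_nonneg (AffineMap.const ℝ _ b - (innerₛₗ ℝ a).toAffineMap) ?_ ?_ hne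
    · intro x hx
      simpa using h x hx
    · ext x
      simp [hF, sub_eq_zero, @eq_comm _ b]
  · refine exists_eq_faceOf_of_nonneg ((innerₛₗ ℝ a).toAffineMap - AffineMap.const ℝ _ b) ?_ ?_ hne
    · intro x hx
      simpa using h x hx
    · simp [hF, sub_eq_zero]

/-- The sum of the `s i` over `D` is nonnegative on the polyhedron and vanishes exactly where all
its terms do, so it gives the supporting hyperplane. -/
lemma isFace_faceOf {D : Finset ℕ} (hD : D ⊆ Finset.range N) :
    IsFace (polyhedron N s) (faceOf N s D) := by
  have hsum : ∀ x ∈ polyhedron N s, (x ∈ faceOf N s D ↔ ∑ i ∈ D, s i x = 0) := by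
    intro x hx
    rw [Finset.sum_eq_zero_iff_of_nonneg fun i hi => hx i (Finset.mem_range.1 (hD hi))]
    exact ⟨fun h => h.2, fun h => ⟨hx, h⟩⟩
  obtain ⟨a, c, hac⟩ := exists_inner_rep (∑ i ∈ D, s i)
  have hac' : ∀ x, ∑ i ∈ D, s i x = c + inner ℝ a x := by
    intro x
    rw [← hac x, sum_affineMap_apply]
  have hF : faceOf N s D = polyhedron N s ∩ {x | inner ℝ a x = -c} := by
    ext x
    refine ⟨fun h => ⟨h.1, ?_⟩, fun h => (hsum x h.1).2 ?_⟩
    · have := (hsum x h.1).1 h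
      rw [hac'] at this
      show inner ℝ a x = -c
      linarith
    · rw [hac', h.2]; ring
  -- If the sum is constant it defines no hyperplane, and the face is the whole polyhedron or empty.
  by_cases ha : a = 0
  · by_cases hc : c = 0
    · right; left
      simp [hF, ha, hc]
    · left
      rw [hF]
      ext x
      simp [ha, eq_comm, hc]
  · right; right
    refine ⟨a, -c, ha, Or.inr fun x hx => ?_, hF⟩
    have := Finset.sum_nonneg fun i (hi : i ∈ D) => hx i (Finset.mem_range.1 (hD hi))
    rw [hac'] at this
    linarith

lemma faceOf_empty : faceOf N s ∅ = polyhedron N s := by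
  ext; simp [faceOf]

/-- The nonempty faces of a polyhedron correspond to the active sets of its points. -/
theorem nonempty_orderIso_faceLattice :
    Nonempty (WithBot (activeSets N s)ᵒᵈ ≃o FaceLattice (polyhedron N s)) := by
  let g : WithBot (activeSets N s)ᵒᵈ → FaceLattice (polyhedron N s) :=
    WithBot.recBotCoe ⟨∅, Or.inl rfl⟩ fun D => ⟨faceOf N s (OrderDual.ofDual D).1, by
      obtain ⟨x, -, hx⟩ := (OrderDual.ofDual D).2
      exact isFace_faceOf (hx ▸ activeSet_subset_range x)⟩
  have hg : ∀ D D', g D ≤ g D' ↔ D ≤ D' := by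
    intro D D'
    induction D using WithBot.recBotCoe with
    | bot => exact iff_of_true (Set.empty_subset _) bot_le
    | coe D =>
      obtain ⟨x, hx, hxD⟩ := (OrderDual.ofDual D).2
      induction D' using WithBot.recBotCoe with
      | bot =>
        refine iff_of_false (fun h => ?_) (WithBot.not_coe_le_bot D)
        have h : faceOf N s (OrderDual.ofDual D).1 ⊆ ∅ := h
        rw [← hxD] at h
        exact h (mem_faceOf_activeSet hx)
      | coe D' =>
        obtain ⟨x', hx', hxD'⟩ := (OrderDual.ofDual D').2
        rw [WithBot.coe_le_coe]
        change faceOf N s (OrderDual.ofDual D).1 ⊆ faceOf N s (OrderDual.ofDual D').1 ↔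
          (OrderDual.ofDual D').1 ⊆ (OrderDual.ofDual D).1
        rw [← hxD, ← hxD']
        exact faceOf_activeSet_subset_iff hx (activeSet_subset_range x')
  refine ⟨RelIso.ofSurjective (OrderEmbedding.ofMapLEIff g hg) ?_⟩
  rintro ⟨F, hF⟩
  rcases F.eq_empty_or_nonempty with rfl | hne
  · exact ⟨⊥, rfl⟩
  · obtain ⟨x, hx, rfl⟩ := hF.exists_eq_faceOf hne
    exact ⟨WithBot.some (OrderDual.toDual ⟨_, x, hx, rfl⟩), rfl⟩

end Polyhedron

end ConvexPolytope

/-! ### The effect of a vertex shaving on the active sets -/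

namespace ConvexPolytope

section Shaving

open AffineMap

variable {n N : ℕ} {s : ℕ → EuclideanSpace ℝ (Fin n) →ᵃ[ℝ] ℝ}

lemma polyhedron_succ_update (f : EuclideanSpace ℝ (Fin n) →ᵃ[ℝ] ℝ) :
    polyhedron (N + 1) (Function.update s N f) = polyhedron N s ∩ {x | 0 ≤ f x} := by
  ext x
  simp only [polyhedron, Set.mem_ofPred_eq, Set.mem_inter_iff, Nat.lt_succ_iff_lt_or_eq]
  constructor
  · intro h
    refine ⟨fun i hi => ?_, by simpa using h N (Or.inr rfl)⟩
    simpa [hi.ne] using h i (Or.inl hi)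
  · rintro ⟨h, hf⟩ i (hi | rfl)
    · simpa [hi.ne] using h i hi
    · simpa using hf

lemma activeSet_succ_update_of_ne (f : EuclideanSpace ℝ (Fin n) →ᵃ[ℝ] ℝ)
    {x : EuclideanSpace ℝ (Fin n)} (hx : f x ≠ 0) :
    activeSet (N + 1) (Function.update s N f) x = activeSet N s x := by
  ext i
  rw [mem_activeSet, mem_activeSet, Nat.lt_succ_iff_lt_or_eq]
  by_cases h : i = N
  · subst h; simp [hx]
  · simp [h]

lemma activeSet_succ_update_of_eq (f : EuclideanSpace ℝ (Fin n) →ᵃ[ℝ] ℝ)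
    {x : EuclideanSpace ℝ (Fin n)} (hx : f x = 0) :
    activeSet (N + 1) (Function.update s N f) x = insert N (activeSet N s x) := by
  ext i
  rw [mem_activeSet, Finset.mem_insert, mem_activeSet, Nat.lt_succ_iff_lt_or_eq]
  by_cases h : i = N
  · subst h; simp [hx]
  · simp [h]

/-- A vertex at which the inequalities in `V` are tight is cut off by requiring the sum of these
inequalities to be at least some small `ε`. -/
theorem exists_shaving (hc : IsCompact (polyhedron N s)) {V : Finset ℕ}
    (hV : V ∈ activeSets N s) (hmax : ∀ D ∈ activeSets N s, V ⊆ D → D = V)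
    (hinj : ∀ x y, (∀ i ∈ V, s i x = s i y) → x = y)
    (hsub : ∀ D, D ⊂ V → D ∈ activeSets N s) :
    ∃ ε : ℝ, ∀ f, f = ∑ i ∈ V, s i - AffineMap.const ℝ _ ε →
      IsVertexShaving (polyhedron N s) (polyhedron (N + 1) (Function.update s N f)) ∧
      activeSets (N + 1) (Function.update s N f) =
        (activeSets N s \ {V}) ∪ {D | ∃ D', D' ⊂ V ∧ D = insert N D'} := by
  obtain ⟨v, hv, hvV⟩ := hV
  have hVN : V ⊆ Finset.range N := hvV ▸ activeSet_subset_range v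
  have hv0 : ∀ i ∈ V, s i v = 0 := fun i hi => (mem_activeSet.1 (hvV ▸ hi)).2
  set σ : EuclideanSpace ℝ (Fin n) → ℝ := fun x => ∑ i ∈ V, s i x with hσ
  have hσv : σ v = 0 := Finset.sum_eq_zero hv0
  have hσcont : Continuous σ :=
    continuous_finsetSum _ fun i _ => (s i).continuous_of_finiteDimensional
  have hσpos : ∀ x ∈ polyhedron N s, activeSet N s x ≠ V → 0 < σ x := by
    intro x hx hne
    have hnn : ∀ i ∈ V, 0 ≤ s i x := fun i hi => hx i (Finset.mem_range.1 (hVN hi))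
    refine lt_of_le_of_ne (Finset.sum_nonneg hnn) fun h => hne ?_
    rw [eq_comm, hσ, Finset.sum_eq_zero_iff_of_nonneg hnn] at h
    exact hmax _ ⟨x, hx, rfl⟩ fun i hi => mem_activeSet.2 ⟨Finset.mem_range.1 (hVN hi), h i hi⟩
  have hrep : ∀ D : Finset ℕ, ∃ x, D ∈ activeSets N s → x ∈ polyhedron N s ∧ activeSet N s x = D := by
    intro D
    by_cases h : D ∈ activeSets N s
    · obtain ⟨x, hx⟩ := h
      exact ⟨x, fun _ => hx⟩
    · exact ⟨v, fun h' => absurd h' h⟩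
  choose p hp using hrep
  -- `σ` vanishes on the polyhedron only at `v`, so it has a positive lower bound `δ` on the compact
  -- union of the facets missing `v` and one representative point for each other active set. Cutting
  -- at `δ / 2` then keeps all representatives and meets only inequalities of `V`.
  obtain ⟨δ, hδ, hδK⟩ : ∃ δ, 0 < δ ∧ ∀ x ∈ (⋃ j ∈ Finset.range N \ V, polyhedron N s ∩ s j ⁻¹' {0}) ∪
      p '' (activeSets N s \ {V}), δ ≤ σ x := by
    refine IsCompact.exists_forall_le' (IsCompact.union ?_ ?_) hσcont.continuousOn ?_
    · exact (Finset.range N \ V).isCompact_biUnion fun j _ =>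
        hc.inter_right (isClosed_singleton.preimage (s j).continuous_of_finiteDimensional)
    · exact ((finite_activeSets.sdiff).image p).isCompact
    · rintro x (hx | ⟨D, hD, rfl⟩)
      · simp only [Set.mem_iUnion] at hx
        obtain ⟨j, hj, hx, hjx⟩ := hx
        rw [Finset.mem_sdiff, Finset.mem_range] at hj
        exact hσpos x hx fun h => hj.2 (h ▸ mem_activeSet.2 ⟨hj.1, hjx⟩)
      · exact hσpos _ (hp D hD.1).1 ((hp D hD.1).2.symm ▸ hD.2)
  have hactive : ∀ x ∈ polyhedron N s, σ x < δ → activeSet N s x ⊆ V := by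
    intro x hx hlt j hj
    by_contra hjV
    refine absurd (hδK x (Or.inl ?_)) (not_le.2 hlt)
    simp only [Set.mem_iUnion]
    exact ⟨j, Finset.mem_sdiff.2 ⟨activeSet_subset_range x hj, hjV⟩, hx, (mem_activeSet.1 hj).2⟩
  have hpδ : ∀ D ∈ activeSets N s, D ≠ V → δ ≤ σ (p D) := fun D hD hne =>
    hδK _ (Or.inr ⟨D, ⟨hD, hne⟩, rfl⟩)
  refine ⟨δ / 2, fun f hf => ?_⟩
  have hfx : ∀ x, f x = σ x - δ / 2 := by
    intro x
    simp [hf, hσ, sum_affineMap_apply]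
  constructor
  · obtain ⟨a, c, hac⟩ := exists_inner_rep f
    refine ⟨v, ?_, -a, c, ?_, ?_, ?_⟩
    · have : ({v} : Set (EuclideanSpace ℝ (Fin n))) = faceOf N s V := by
        ext x
        refine ⟨?_, fun h => hinj x v fun i hi => (h.2 i hi).trans (hv0 i hi).symm⟩
        rintro rfl
        exact ⟨hv, hv0⟩
      rw [IsVertex, this]
      exact isFace_faceOf hVN
    · have h1 := hfx v
      rw [hac, hσv] at h1
      rw [inner_neg_left]
      linarith
    -- A vertex is the only point of its face, hence equals the chosen representative of its active
    -- set.
    · intro v' hv' hne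
      obtain ⟨x, hx, hF⟩ := IsFace.exists_eq_faceOf hv' (Set.singleton_nonempty v')
      have hDx := (hp _ ⟨x, hx, rfl⟩).2
      have hmem : p (activeSet N s x) ∈ faceOf N s (activeSet N s x) := by
        have := mem_faceOf_activeSet (hp _ ⟨x, hx, rfl⟩).1
        rwa [hDx] at this
      rw [← hF] at hmem
      have hxne : activeSet N s x ≠ V := by
        intro h
        have hv'F : v' ∈ faceOf N s V := h ▸ hF ▸ Set.mem_singleton v'
        exact hne (hinj _ _ fun i hi => (hv'F.2 i hi).trans (hv0 i hi).symm)
      have h1 := hpδ _ ⟨x, hx, rfl⟩ hxne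
      rw [Set.mem_singleton_iff.1 hmem] at h1
      have h2 := hfx v'
      rw [hac] at h2
      rw [inner_neg_left]
      linarith
    · rw [polyhedron_succ_update]
      ext x
      simp only [Set.mem_inter_iff, Set.mem_ofPred_eq, hac, inner_neg_left]
      exact and_congr_right fun _ => ⟨fun h => by linarith, fun h => by linarith⟩
  · ext D
    constructor
    · rintro ⟨x, hx, rfl⟩
      rw [polyhedron_succ_update] at hx
      obtain ⟨hx, hfx0⟩ := hx
      have hfx0 : 0 ≤ f x := hfx0
      have hne : activeSet N s x ≠ V := by
        intro h
        have : σ x = 0 := Finset.sum_eq_zero fun i hi => (mem_activeSet.1 (h ▸ hi)).2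
        rw [hfx] at hfx0
        linarith
      by_cases h0 : f x = 0
      · right
        refine ⟨_, ?_, activeSet_succ_update_of_eq f h0⟩
        rw [hfx] at h0
        exact lt_of_le_of_ne (hactive x hx (by linarith)) hne
      · left
        rw [activeSet_succ_update_of_ne f h0]
        exact ⟨⟨x, hx, rfl⟩, hne⟩
    · rintro (⟨hD, hDV⟩ | ⟨D', hD', rfl⟩)
      · have h1 := hpδ D hD hDV
        have h2 : 0 < f (p D) := by rw [hfx]; linarith
        refine ⟨p D, ?_, ?_⟩
        · rw [polyhedron_succ_update]
          exact ⟨(hp D hD).1, h2.le⟩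
        · rw [activeSet_succ_update_of_ne f h2.ne', (hp D hD).2]
      · have hD := hsub D' hD'
        have h1 := hpδ D' hD hD'.ne
        obtain ⟨hpP, hpD⟩ := hp D' hD
        set y := p D'
        have hy0 : 0 < σ y := by linarith
        -- The point of the segment from `v` to `y` where `σ = δ / 2`; its old active set is that of
        -- `y`, since all of `D' ⊂ V` is active at `v` too.
        set t : ℝ := δ / 2 / σ y
        have ht0 : 0 < t := by positivity
        have ht1 : t < 1 := by rw [div_lt_one hy0]; linarith
        have hz : lineMap v y t ∈ polyhedron N s :=
          convex_polyhedron.segment_subset hv hpP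
            (lineMap_mem_segment ℝ v y ⟨ht0.le, ht1.le⟩)
        have hσz : σ (lineMap v y t) = δ / 2 := by
          have : σ (lineMap v y t) = (1 - t) * σ v + t * σ y := by
            simp only [hσ, apply_lineMap_eq, Finset.sum_add_distrib, Finset.mul_sum]
          rw [this, hσv]
          simp only [t]
          field_simp
          ring
        have hfz : f (lineMap v y t) = 0 := by rw [hfx, hσz, sub_self]
        refine ⟨lineMap v y t, ?_, ?_⟩
        · rw [polyhedron_succ_update]
          exact ⟨hz, hfz.ge⟩
        · rw [activeSet_succ_update_of_eq f hfz]
          congr 1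
          rw [← hpD]
          ext i
          simp only [mem_activeSet, and_congr_right_iff, apply_lineMap_eq]
          intro hi
          have hv1 := hv i hi
          have hy1 := hpP i hi
          constructor
          · intro h
            nlinarith
          · intro h
            have : i ∈ V := hD'.1 (hpD ▸ mem_activeSet.2 ⟨hi, h⟩)
            rw [hv0 i this, h]; ring

end Shaving

end ConvexPolytope

/-! ### Dimension and number of facets -/

namespace ConvexPolytope

section Facets

open AffineMap Filter Topology

variable {n N : ℕ} {s : ℕ → EuclideanSpace ℝ (Fin n) →ᵃ[ℝ] ℝ}

lemma dim_of_nonempty {P : Set (EuclideanSpace ℝ (Fin n))} (h : P.Nonempty) :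
    dim P = Module.finrank ℝ (vectorSpan ℝ P) := by
  rw [dim, if_neg h.ne_empty]

lemma vectorSpan_faceOf_le {D : Finset ℕ} {i : ℕ} (hi : i ∈ D) :
    vectorSpan ℝ (faceOf N s D) ≤ LinearMap.ker (s i).linear := by
  rw [vectorSpan_def, Submodule.span_le]
  rintro _ ⟨x, hx, y, hy, rfl⟩
  simp only [SetLike.mem_coe, LinearMap.mem_ker, AffineMap.linearMap_vsub]
  rw [hx.2 i hi, hy.2 i hi]
  simp

/-- From `x`, a small move in any direction killed by the active linear parts stays in the face. -/
lemma vectorSpan_faceOf_activeSet {x : EuclideanSpace ℝ (Fin n)} (hx : x ∈ polyhedron N s) :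
    vectorSpan ℝ (faceOf N s (activeSet N s x)) =
      ⨅ i ∈ activeSet N s x, LinearMap.ker (s i).linear := by
  refine le_antisymm (le_iInf₂ fun i hi => vectorSpan_faceOf_le hi) fun u hu => ?_
  simp only [Submodule.mem_iInf, LinearMap.mem_ker] at hu
  have hxu : ∀ i ∈ activeSet N s x, s i (u +ᵥ x) = 0 := by
    intro i hi
    rw [AffineMap.map_vadd, hu i hi, (mem_activeSet.1 hi).2]
    simp
  have hev := (eventually_lineMap_mem_polyhedron hx hxu).filter_mono
    (nhdsWithin_le_nhds (s := Set.Ioi 0))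
  obtain ⟨t, ht, ht0⟩ := (hev.and self_mem_nhdsWithin).exists
  have ht0 : t ≠ 0 := (Set.mem_Ioi.1 ht0).ne'
  have hz : lineMap x (u +ᵥ x) t ∈ faceOf N s (activeSet N s x) := by
    refine ⟨ht, fun i hi => ?_⟩
    rw [apply_lineMap_eq, hxu i hi, (mem_activeSet.1 hi).2]
    ring
  have := vsub_mem_vectorSpan ℝ hz (mem_faceOf_activeSet hx)
  have h2 : (lineMap x (u +ᵥ x) t : EuclideanSpace ℝ (Fin n)) -ᵥ x = t • u := by
    simp [AffineMap.lineMap_apply]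
  rw [h2] at this
  exact (Submodule.smul_mem_iff _ ht0).1 this

lemma dim_polyhedron (h0 : ∅ ∈ activeSets N s) : dim (polyhedron N s) = n := by
  obtain ⟨x, hx, hx0⟩ := h0
  have := vectorSpan_faceOf_activeSet hx
  rw [hx0, faceOf_empty] at this
  have htop : vectorSpan ℝ (polyhedron N s) = ⊤ := by
    rw [this]
    exact iInf₂_eq_top.2 fun i hi => absurd hi (Finset.notMem_empty i)
  rw [dim_of_nonempty ⟨x, hx⟩, htop, finrank_top, finrank_euclideanSpace_fin]

lemma faceOf_singleton_injOn (h1 : ∀ i < N, {i} ∈ activeSets N s) :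
    Set.InjOn (fun i => faceOf N s {i}) (Set.Iio N) := by
  intro i hi j hj hij
  obtain ⟨x, hx, hxi⟩ := h1 i hi
  have hij : faceOf N s {i} = faceOf N s {j} := hij
  have h := (faceOf_activeSet_subset_iff hx (D := {j}) (by simpa using hj)).1
    (by rw [hxi]; exact hij.subset)
  rw [hxi] at h
  exact (Finset.mem_singleton.1 (h (Finset.mem_singleton_self j))).symm

lemma finrank_ker_linear (h0 : ∅ ∈ activeSets N s) (h1 : ∀ i < N, {i} ∈ activeSets N s)
    {i : ℕ} (hi : i < N) : Module.finrank ℝ (LinearMap.ker (s i).linear) + 1 = n := by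
  have hne : (s i).linear ≠ 0 := by
    intro h
    obtain ⟨x, hx, hx0⟩ := h0
    obtain ⟨y, hy, hyi⟩ := h1 i hi
    have hy0 : s i y = 0 := (mem_activeSet.1 (hyi ▸ Finset.mem_singleton_self i)).2
    have hxy : s i x = s i y := by
      have := (s i).linearMap_vsub x y
      rw [h] at this
      simpa [sub_eq_zero] using this.symm
    have : i ∈ activeSet N s x := mem_activeSet.2 ⟨hi, hxy.trans hy0⟩
    simp [hx0] at this
  rw [Module.Dual.finrank_ker_add_one_of_ne_zero hne, finrank_euclideanSpace_fin]

theorem ncard_facets_polyhedron (hn : n ≠ 0) (h0 : ∅ ∈ activeSets N s)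
    (h1 : ∀ i < N, {i} ∈ activeSets N s) : (facets (polyhedron N s)).ncard = N := by
  have hfacets : facets (polyhedron N s) = (fun i => faceOf N s {i}) '' Set.Iio N := by
    ext F
    constructor
    · rintro ⟨hF, hdim⟩
      rw [dim_polyhedron h0] at hdim
      have hne : F.Nonempty := by
        rw [Set.nonempty_iff_ne_empty]
        rintro rfl
        simp only [dim, if_true] at hdim
        omega
      obtain ⟨x, hx, rfl⟩ := hF.exists_eq_faceOf hne
      rw [dim_of_nonempty hne] at hdim
      rcases (activeSet N s x).eq_empty_or_nonempty with h | ⟨i, hi⟩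
      · rw [h, faceOf_empty, ← dim_of_nonempty ⟨x, hx⟩, dim_polyhedron h0] at hdim
        omega
      · have hiN := (mem_activeSet.1 hi).1
        refine ⟨i, hiN, ?_⟩
        suffices h : activeSet N s x = {i} by rw [h]
        refine Finset.eq_singleton_iff_unique_mem.2 ⟨hi, fun j hj => ?_⟩
        -- With a second active index `j`, the dimension count makes the direction space of the face
        -- all of `ker (s i).linear`, so `s j` would vanish wherever `s i` does, against the point
        -- with active set `{i}`.
        by_contra hji
        have hk := finrank_ker_linear h0 h1 hiN
        have hle : vectorSpan ℝ (faceOf N s (activeSet N s x)) ≤ LinearMap.ker (s i).linear :=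
          vectorSpan_faceOf_le hi
        have heq := Submodule.eq_of_le_of_finrank_eq hle (by omega)
        obtain ⟨y, hy, hyi⟩ := h1 i hiN
        have hyx : y -ᵥ x ∈ LinearMap.ker (s i).linear := by
          rw [LinearMap.mem_ker, AffineMap.linearMap_vsub, (mem_activeSet.1 hi).2,
            (mem_activeSet.1 (hyi ▸ Finset.mem_singleton_self i)).2]
          simp
        rw [← heq] at hyx
        have hyj := vectorSpan_faceOf_le hj hyx
        rw [LinearMap.mem_ker, AffineMap.linearMap_vsub, (mem_activeSet.1 hj).2] at hyj
        have : j ∈ activeSet N s y := mem_activeSet.2 ⟨(mem_activeSet.1 hj).1, by simpa using hyj⟩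
        rw [hyi, Finset.mem_singleton] at this
        exact hji this
    · rintro ⟨i, hi, rfl⟩
      refine ⟨isFace_faceOf (by simpa using hi), ?_⟩
      have hk := finrank_ker_linear h0 h1 hi
      obtain ⟨x, hx, hxi⟩ := h1 i hi
      have hspan := vectorSpan_faceOf_activeSet hx
      rw [hxi] at hspan
      rw [dim_polyhedron h0, dim_of_nonempty (P := faceOf N s {i})
        ⟨x, hxi ▸ mem_faceOf_activeSet hx⟩]
      simp only [Finset.mem_singleton, iInf_iInf_eq_left] at hspan
      rw [hspan]
      omega
  rw [hfacets, (faceOf_singleton_injOn h1).ncard_image]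
  simp [← Finset.coe_Iio]

lemma facets_eq_of_dim_eq_zero {P : Set (EuclideanSpace ℝ (Fin n))} (h : dim P = 0) :
    facets P = {∅} := by
  ext F
  simp only [facets, Set.mem_ofPred_eq, h, Set.mem_singleton_iff]
  constructor
  · rintro ⟨-, hF⟩
    by_contra hne
    rw [dim_of_nonempty (Set.nonempty_iff_ne_empty.2 hne)] at hF
    omega
  · rintro rfl
    exact ⟨Or.inl rfl, by simp [dim]⟩

end Facets

end ConvexPolytope

/-! ### Combinatorics of the stacked complex -/

namespace ConvexPolytope

section StackedComplex

/-- The boundary complex of the stack of the simplices `{i, …, i + d}` for `i ≤ k`: its faces are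
the sets contained in one of these simplices, other than the simplices themselves and the walls
`{i + 1, …, i + d}` between consecutive simplices. -/
def stackedComplex (d k : ℕ) : Set (Finset ℕ) :=
  {D | (∃ i ≤ k, D ⊆ Finset.Icc i (i + d)) ∧ D.card ≤ d ∧
    ∀ i < k, D ≠ Finset.Icc (i + 1) (i + d)}

variable {d k : ℕ}

lemma stackedComplex_zero : stackedComplex d 0 = {D | D ⊂ Finset.range (d + 1)} := by
  ext D
  have h : Finset.Icc 0 (0 + d) = Finset.range (d + 1) := by ext; simp
  simp only [stackedComplex, Set.mem_ofPred_eq, Nat.le_zero, exists_eq_left, h, Nat.not_lt_zero,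
    false_imp_iff, implies_true, and_true]
  constructor
  · rintro ⟨h1, h2⟩
    exact lt_of_le_of_ne h1 fun h => by simp [h] at h2
  · intro h1
    have := Finset.card_lt_card h1
    simp at this
    exact ⟨h1.1, by omega⟩

lemma subset_range_of_mem_stackedComplex {D : Finset ℕ} (hD : D ∈ stackedComplex d k) :
    D ⊆ Finset.range (d + k + 1) := by
  obtain ⟨⟨i, hi, h⟩, -⟩ := hD
  intro j hj
  have := Finset.mem_Icc.1 (h hj)
  rw [Finset.mem_range]; omega

lemma card_Icc_succ_add (i d : ℕ) : (Finset.Icc (i + 1) (i + d)).card = d := by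
  rw [Nat.card_Icc]; omega

lemma Icc_succ_add_injective (hd : d ≠ 0) {i j : ℕ}
    (h : Finset.Icc (i + 1) (i + d) = Finset.Icc (j + 1) (j + d)) : i = j := by
  have h1 : i + 1 ∈ Finset.Icc (j + 1) (j + d) := h ▸ Finset.mem_Icc.2 (by omega)
  have h2 : j + 1 ∈ Finset.Icc (i + 1) (i + d) := h ▸ Finset.mem_Icc.2 (by omega)
  rw [Finset.mem_Icc] at h1 h2
  omega

/-- This is the wall that the next simplex is glued to: dually, the vertex shaved off next. -/
lemma Icc_mem_stackedComplex (hd : d ≠ 0) : Finset.Icc (k + 1) (k + d) ∈ stackedComplex d k :=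
  ⟨⟨k, le_rfl, Finset.Icc_subset_Icc (by omega) le_rfl⟩, (card_Icc_succ_add k d).le,
    fun _ hi h => hi.ne' (Icc_succ_add_injective hd h)⟩

lemma mem_stackedComplex_of_ssubset {D : Finset ℕ} (hD : D ⊂ Finset.Icc (k + 1) (k + d)) :
    D ∈ stackedComplex d k := by
  have hcard := Finset.card_lt_card hD
  rw [card_Icc_succ_add] at hcard
  refine ⟨⟨k, le_rfl, hD.1.trans (Finset.Icc_subset_Icc (by omega) le_rfl)⟩, hcard.le,
    fun i _ h => ?_⟩
  rw [h, card_Icc_succ_add] at hcard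
  exact lt_irrefl _ hcard

/-- The new index `d + k + 1` lies in the last window only, and a face avoiding it already fits in
an old window. The right side has the form produced by `exists_shaving`. -/
lemma stackedComplex_succ :
    stackedComplex d (k + 1) = (stackedComplex d k \ {Finset.Icc (k + 1) (k + d)}) ∪
      {D | ∃ D', D' ⊂ Finset.Icc (k + 1) (k + d) ∧ D = insert (d + k + 1) D'} := by
  ext D
  constructor
  · rintro ⟨⟨i, hi, hDi⟩, hcard, hwall⟩
    by_cases hmem : d + k + 1 ∈ D
    · right
      have hi' : i = k + 1 := by
        have := Finset.mem_Icc.1 (hDi hmem)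
        omega
      subst hi'
      refine ⟨D.erase (d + k + 1), lt_of_le_of_ne (fun j hj => ?_) (fun h => ?_),
        (Finset.insert_erase hmem).symm⟩
      · obtain ⟨hne, hj⟩ := Finset.mem_erase.1 hj
        have := Finset.mem_Icc.1 (hDi hj)
        exact Finset.mem_Icc.2 (by omega)
      · have := Finset.card_erase_add_one hmem
        rw [h, card_Icc_succ_add] at this
        omega
    · left
      refine ⟨⟨?_, hcard, fun j hj => hwall j (by omega)⟩, hwall k (by omega)⟩
      rcases Nat.lt_succ_iff_lt_or_eq.1 (Nat.lt_succ_of_le hi) with hi | rfl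
      · exact ⟨i, by omega, hDi⟩
      · refine ⟨k, le_rfl, fun j hj => ?_⟩
        have := Finset.mem_Icc.1 (hDi hj)
        have : j ≠ d + k + 1 := fun h => hmem (h ▸ hj)
        exact Finset.mem_Icc.2 (by omega)
  · rintro (⟨⟨⟨i, hi, hDi⟩, hcard, hwall⟩, hne⟩ | ⟨D', hD', rfl⟩)
    · refine ⟨⟨i, by omega, hDi⟩, hcard, fun j hj => ?_⟩
      rcases Nat.lt_succ_iff_lt_or_eq.1 hj with hj | rfl
      · exact hwall j hj
      · exact hne
    · have hcard := Finset.card_lt_card hD'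
      rw [card_Icc_succ_add] at hcard
      refine ⟨⟨k + 1, le_rfl, ?_⟩, (Finset.card_insert_le _ _).trans hcard, fun i hi h => ?_⟩
      · refine Finset.insert_subset (Finset.mem_Icc.2 (by omega)) (hD'.1.trans ?_)
        exact Finset.Icc_subset_Icc (by omega) (by omega)
      · have : d + k + 1 ∈ Finset.Icc (i + 1) (i + d) := h ▸ Finset.mem_insert_self _ _
        have := Finset.mem_Icc.1 this
        omega

lemma empty_mem_stackedComplex (h : d ≠ 0 ∨ k = 0) : ∅ ∈ stackedComplex d k := by
  refine ⟨⟨0, by simp⟩, by simp, fun i hi h' => ?_⟩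
  have := card_Icc_succ_add i d
  rw [← h'] at this
  simp at this
  omega

/-- For `d = 1` the walls are themselves singletons, so `k = 0` is required there. -/
lemma singleton_mem_stackedComplex (h : 2 ≤ d ∨ d = 1 ∧ k = 0) {i : ℕ} (hi : i < d + k + 1) :
    {i} ∈ stackedComplex d k := by
  refine ⟨⟨min i k, by simp, by simp; omega⟩, by simp; omega, fun j hj h' => ?_⟩
  have := card_Icc_succ_add j d
  rw [← h'] at this
  simp at this
  omega

end StackedComplex

/-! ### Realization by dual stacked polytopes -/

section Stacking

variable {d : ℕ}

/-- The inequalities are the barycentric coordinates. They sum to `1`, so they cannot all vanish,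
and any `d` of them determine the point. -/
lemma exists_simplex_polyhedron (d : ℕ) :
    ∃ s : ℕ → EuclideanSpace ℝ (Fin d) →ᵃ[ℝ] ℝ,
      IsDualStacked (polyhedron (d + 1) s) ∧ IsCompact (polyhedron (d + 1) s) ∧
      activeSets (d + 1) s = {D | D ⊂ Finset.range (d + 1)} ∧
      ∀ x y, (∀ i ∈ Finset.Icc 1 d, s i x = s i y) → x = y := by
  obtain ⟨b⟩ : Nonempty (AffineBasis (Fin (d + 1)) ℝ (EuclideanSpace ℝ (Fin d))) :=
    AffineBasis.exists_affineBasis_of_finiteDimensional (by simp)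
  let s : ℕ → EuclideanSpace ℝ (Fin d) →ᵃ[ℝ] ℝ := fun i =>
    if h : i < d + 1 then b.coord ⟨i, h⟩ else 0
  have hs : ∀ i : Fin (d + 1), s i = b.coord i := fun i =>
    dif_pos i.2
  have hP : polyhedron (d + 1) s = convexHull ℝ (Set.range b) := by
    rw [b.convexHull_eq_nonneg_coord]
    ext x
    exact ⟨fun h i => by rw [← hs]; exact h i i.2, fun h i hi => by
      have := h ⟨i, hi⟩; rwa [← hs] at this⟩
  have hsum : ∀ x, ∑ i ∈ Finset.range (d + 1), s i x = 1 := fun x => by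
    rw [Finset.sum_range, ← b.sum_coord_apply_eq_one x]
    simp [hs]
  refine ⟨s, ?_, ?_, ?_, ?_⟩
  · rw [hP]
    exact IsDualStacked.simplex ⟨b, b.ind⟩
  · rw [hP]
    exact (Set.finite_range b).isCompact_convexHull ℝ
  · ext D
    constructor
    · rintro ⟨x, hx, rfl⟩
      refine lt_of_le_of_ne (activeSet_subset_range x) fun h => ?_
      have h1 := hsum x
      rw [← h, Finset.sum_eq_zero fun i hi => (mem_activeSet.1 hi).2] at h1
      exact zero_ne_one h1
    · intro hD
      -- The barycentre of the vertices outside `D` has active set exactly `D`.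
      set E := Finset.univ.filter fun i : Fin (d + 1) => i.1 ∉ D with hE
      have hEne : E.Nonempty := by
        obtain ⟨i, hi, hiD⟩ := Finset.exists_of_ssubset hD
        exact ⟨⟨i, Finset.mem_range.1 hi⟩, by simp [hE, hiD]⟩
      have hEpos : (0 : ℝ) < E.card := by exact_mod_cast hEne.card_pos
      let w : Fin (d + 1) → ℝ := fun i => if i ∈ E then (E.card : ℝ)⁻¹ else 0
      have hw : ∑ i, w i = 1 := by
        simp only [w, Finset.sum_ite_mem, Finset.univ_inter, Finset.sum_const, nsmul_eq_mul]
        exact mul_inv_cancel₀ hEpos.ne'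
      have hx : ∀ i : Fin (d + 1), s i (Finset.univ.affineCombination ℝ b w) = w i := fun i => by
        rw [hs, b.coord_apply_combination_of_mem (Finset.mem_univ i) hw]
      refine ⟨Finset.univ.affineCombination ℝ b w, fun i hi => ?_, ?_⟩
      · have := hx ⟨i, hi⟩
        simp only at this
        rw [this]
        simp only [w]
        split_ifs <;> positivity
      · ext i
        rw [mem_activeSet]
        constructor
        · rintro ⟨hi, h0⟩
          have := hx ⟨i, hi⟩
          simp only at this
          rw [this] at h0
          by_contra hiD
          simp [w, hE, hiD] at h0
          exact hEpos.ne' (by simpa [hE] using h0)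
        · intro hiD
          have hi := Finset.mem_range.1 (hD.1 hiD)
          refine ⟨hi, ?_⟩
          have := hx ⟨i, hi⟩
          simp only at this
          rw [this]
          simp [w, hE, hiD]
  · intro x y h
    have h' : ∀ i ∈ Finset.range d, s (i + 1) x = s (i + 1) y := fun i hi =>
      h _ (Finset.mem_Icc.2 (by have := Finset.mem_range.1 hi; omega))
    refine b.ext_elem fun i => ?_
    rw [← hs]
    rcases Nat.eq_zero_or_pos i.1 with hi | hi
    · rw [hi]
      have hx := hsum x
      have hy := hsum y
      rw [Finset.sum_range_succ', Finset.sum_congr rfl h'] at hx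
      rw [Finset.sum_range_succ'] at hy
      linarith
    · exact h _ (Finset.mem_Icc.2 (by omega))

/-- The boundary complex of a stack of simplices is the complex of active sets of a dual stacked
polytope. -/
theorem exists_dualStacked_polyhedron {k : ℕ} (h : d ≠ 0 ∨ k = 0) :
    ∃ s : ℕ → EuclideanSpace ℝ (Fin d) →ᵃ[ℝ] ℝ,
      IsDualStacked (polyhedron (d + k + 1) s) ∧ IsCompact (polyhedron (d + k + 1) s) ∧
      activeSets (d + k + 1) s = stackedComplex d k ∧
      ∀ x y, (∀ i ∈ Finset.Icc (k + 1) (k + d), s i x = s i y) → x = y := by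
  induction k with
  | zero =>
    simpa only [stackedComplex_zero, Nat.add_zero, Nat.zero_add] using exists_simplex_polyhedron d
  | succ k ih =>
    have hd : d ≠ 0 := by omega
    obtain ⟨s, hP, hc, hT, hinj⟩ := ih (Or.inl hd)
    obtain ⟨ε, hε⟩ := exists_shaving hc (hT ▸ Icc_mem_stackedComplex hd)
      (fun D hD hVD => (Finset.eq_of_subset_of_card_le hVD
        (by rw [hT] at hD; rw [card_Icc_succ_add]; exact hD.2.1)).symm) hinj
      (fun D hD => hT ▸ mem_stackedComplex_of_ssubset hD)
    set f := ∑ i ∈ Finset.Icc (k + 1) (k + d), s i - AffineMap.const ℝ _ ε with hf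
    obtain ⟨hshave, hT'⟩ := hε f rfl
    refine ⟨Function.update s (d + k + 1) f, hP.shave hshave, ?_, ?_, ?_⟩
    · show IsCompact (polyhedron (d + k + 1 + 1) _)
      rw [polyhedron_succ_update]
      exact hc.inter_right
        (isClosed_Ici.preimage f.continuous_of_finiteDimensional)
    · rw [stackedComplex_succ, ← hT]
      exact hT'
    · intro x y hxy
      have hlt : ∀ i ∈ Finset.Icc (k + 1 + 1) (k + d), s i x = s i y := by
        intro i hi
        rw [Finset.mem_Icc] at hi
        have := hxy i (Finset.mem_Icc.2 (by omega))
        rwa [Function.update_of_ne (by omega)] at this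
      have hlast : f x = f y := by
        have := hxy (d + k + 1) (Finset.mem_Icc.2 (by omega))
        simpa using this
      -- The new wall trades `s (k + 1)` for `f`; since `f` is the sum over the old wall minus a
      -- constant, `s (k + 1)` is recovered from `f` and the rest.
      refine hinj x y fun i hi => ?_
      rcases eq_or_ne i (k + 1) with rfl | hne
      · have hfx : ∀ z, f z = s (k + 1) z + ∑ i ∈ Finset.Icc (k + 1 + 1) (k + d), s i z - ε := by
          intro z
          rw [hf, ← Finset.insert_Icc_add_one_left_eq_Icc (show k + 1 ≤ k + d by omega),
            Finset.sum_insert (by simp)]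
          simp [sum_affineMap_apply]
        rw [hfx, hfx, Finset.sum_congr rfl hlt] at hlast
        linarith
      · rw [Finset.mem_Icc] at hi
        exact hlt i (Finset.mem_Icc.2 (by omega))

end Stacking

end ConvexPolytope

/-! ### Subwords of cyclic words as sets of deleted positions -/

section CyclicWord

open ConvexPolytope

lemma List.SortedLT.getElem_add_le {l : List ℕ} (hl : l.SortedLT) {i j : ℕ} (hij : i ≤ j)
    (hj : j < l.length) : l[i] + (j - i) ≤ l[j] := by
  induction j, hij using Nat.le_induction with
  | base => simp
  | succ j hij ih =>
    have h1 := ih (by omega)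
    have h2 : l[j] < l[j + 1] := hl.getElem_lt_getElem_iff.2 (Nat.lt_succ_self j)
    omega

/-- The elements of `{0, …, N - 1}` that are not in `D`, in increasing order. -/
def complList (N : ℕ) (D : Finset ℕ) : List ℕ :=
  (List.range N).filter (· ∉ D)

/-- The cyclic word of length `N`, with the letters at the positions in `D` deleted. -/
def cyclicWordDelete (d N : ℕ) (D : Finset ℕ) : List (Fin (d + 1)) :=
  (complList N D).map (Fin.ofNat (d + 1))

variable {d k N : ℕ} {D D' : Finset ℕ}

lemma mem_complList {i : ℕ} : i ∈ complList N D ↔ i < N ∧ i ∉ D := by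
  simp [complList]

lemma sortedLT_complList : (complList N D).SortedLT :=
  (List.pairwise_lt_range.filter _).sortedLT

lemma length_complList (hD : D ⊆ Finset.range N) : (complList N D).length + D.card = N := by
  have h : (complList N D).toFinset = Finset.range N \ D := by
    ext i; simp [mem_complList]
  rw [← List.toFinset_card_of_nodup sortedLT_complList.nodup, h,
    Finset.card_sdiff_add_card_eq_card hD, Finset.card_range]

lemma le_getElem_complList {j : ℕ} (hj : j < (complList N D).length) : j ≤ (complList N D)[j] := by
  have := sortedLT_complList.getElem_add_le (Nat.zero_le j) hj
  omega

/-- Count back from the last surviving position, which is at most `N - 1`. -/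
lemma getElem_complList_le (hD : D ⊆ Finset.range N) {j : ℕ} (hj : j < (complList N D).length) :
    (complList N D)[j] ≤ j + D.card := by
  have h1 := length_complList hD
  have h2 := sortedLT_complList.getElem_add_le (l := complList N D) (i := j)
    (j := (complList N D).length - 1) (by omega) (by omega)
  have h3 := (mem_complList.1 (List.getElem_mem (l := complList N D)
    (n := (complList N D).length - 1) (by omega))).1
  omega

lemma complList_sublist (h : D' ⊆ D) : (complList N D).Sublist (complList N D') :=
  List.monotone_filter_right _ fun i => by simpa using fun hi hi' => hi (h hi')

lemma exists_eq_complList (hD : D ⊆ Finset.range N) {l : List ℕ} (hl : l.Sublist (complList N D)) :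
    ∃ D', D ⊆ D' ∧ D' ⊆ Finset.range N ∧ l = complList N D' := by
  refine ⟨(Finset.range N).filter (· ∉ l), fun i hi => Finset.mem_filter.2 ⟨hD hi, fun h =>
    (mem_complList.1 (hl.subset h)).2 hi⟩, Finset.filter_subset _ _, ?_⟩
  refine List.SortedLT.eq_of_mem_iff (sortedLT_complList.pairwise.sublist hl).sortedLT
    sortedLT_complList fun i => ?_
  rw [mem_complList, Finset.mem_filter, Finset.mem_range]
  have := fun h => (mem_complList.1 (hl.subset (a := i) h)).1
  tauto

lemma cyclicWordDelete_empty : cyclicWordDelete d N ∅ = cyclicWord d N := by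
  simp [cyclicWordDelete, complList, cyclicWord]

lemma eq_add_of_ofNat_eq {a b : ℕ} (hab : a < b) (hba : b ≤ a + (d + 1))
    (h : Fin.ofNat (d + 1) a = Fin.ofNat (d + 1) b) : b = a + (d + 1) := by
  have h : a % (d + 1) = b % (d + 1) := congrArg Fin.val h
  have := (Nat.modEq_iff_dvd' hab.le).1 h
  have := Nat.le_of_dvd (by omega) this
  omega

/-- The two positions of the `j`-th letter are congruent modulo `d + 1`. If they differed, the
bounds `j ≤ · ≤ j + |D|` with `|D| ≤ d` would put them less than a period apart. -/
lemma cyclicWordDelete_injective (hD : D ⊆ Finset.range N) (hD' : D' ⊆ Finset.range N)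
    (hcard : D.card ≤ d) (h : cyclicWordDelete d N D = cyclicWordDelete d N D') : D = D' := by
  have hlen : (complList N D).length = (complList N D').length := by
    simpa [cyclicWordDelete] using congrArg List.length h
  have h1 := length_complList hD
  have h2 := length_complList hD'
  have hlist : complList N D = complList N D' := by
    refine List.ext_getElem hlen fun j hj hj' => ?_
    have hmod : Fin.ofNat (d + 1) (complList N D)[j] = Fin.ofNat (d + 1) (complList N D')[j] := by
      have := List.getElem_of_eq h (i := j) (by simpa [cyclicWordDelete] using hj)
      simpa only [cyclicWordDelete, List.getElem_map] using this
    have h3 := le_getElem_complList hj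
    have h4 := le_getElem_complList hj'
    have h5 := getElem_complList_le hD hj
    have h6 := getElem_complList_le hD' hj'
    rcases lt_trichotomy (complList N D)[j] (complList N D')[j] with h7 | h7 | h7
    · have := eq_add_of_ofNat_eq h7 (by omega) hmod
      omega
    · exact h7
    · have := eq_add_of_ofNat_eq h7 (by omega) hmod.symm
      omega
  ext i
  have hi : i ∈ complList N D ↔ i ∈ complList N D' := by rw [hlist]
  rw [mem_complList, mem_complList] at hi
  have h3 := fun h => Finset.mem_range.1 (@hD i h)
  have h4 := fun h => Finset.mem_range.1 (@hD' i h)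
  tauto

lemma exists_eq_cyclicWordDelete (hD : D ⊆ Finset.range N) {l : List (Fin (d + 1))}
    (hl : l.Sublist (cyclicWordDelete d N D)) :
    ∃ D', D ⊆ D' ∧ D' ⊆ Finset.range N ∧ l = cyclicWordDelete d N D' := by
  obtain ⟨l', hl', rfl⟩ := List.sublist_map_iff.1 hl
  obtain ⟨D', h1, h2, rfl⟩ := exists_eq_complList hD hl'
  exact ⟨D', h1, h2, rfl⟩

lemma cyclicWordDelete_sublist_iff (hD : D ⊆ Finset.range N) (hD' : D' ⊆ Finset.range N)
    (hcard : D.card ≤ d) :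
    (cyclicWordDelete d N D).Sublist (cyclicWordDelete d N D') ↔ D' ⊆ D := by
  refine ⟨fun h => ?_, fun h => (complList_sublist h).map _⟩
  obtain ⟨D'', h1, h2, h3⟩ := exists_eq_cyclicWordDelete hD' h
  rwa [cyclicWordDelete_injective hD h2 hcard h3]

lemma length_cyclicWordDelete (hD : D ⊆ Finset.range N) :
    (cyclicWordDelete d N D).length + D.card = N := by
  rw [cyclicWordDelete, List.length_map, length_complList hD]

/-- Deleting a full period from a cyclic word gives a shorter cyclic word. -/
lemma cyclicWordDelete_Icc {i : ℕ} (hi : i ≤ k) :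
    cyclicWordDelete d (d + k + 1) (Finset.Icc i (i + d)) = cyclicWord d k := by
  have h : complList (d + k + 1) (Finset.Icc i (i + d)) =
      (List.range k).map fun j => if j < i then j else j + (d + 1) := by
    refine sortedLT_complList.eq_of_mem_iff (List.Pairwise.sortedLT ?_) fun p => ?_
    · refine List.pairwise_map.2 (List.pairwise_lt_range.imp fun {a b} hab => ?_)
      split_ifs <;> omega
    · simp only [mem_complList, Finset.mem_Icc, List.mem_map, List.mem_range]
      constructor
      · rintro ⟨hp, hpi⟩
        by_cases h : p < i
        · exact ⟨p, by omega, if_pos h⟩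
        · exact ⟨p - (d + 1), by omega, by rw [if_neg (by omega)]; omega⟩
      · rintro ⟨j, hj, rfl⟩
        split_ifs <;> omega
  rw [cyclicWordDelete, h, cyclicWord, List.map_map]
  refine List.map_congr_left fun j _ => ?_
  simp only [Function.comp_apply]
  split_ifs
  · rfl
  · simp [Fin.ofNat]

lemma cyclicWord_sublist_cyclicWordDelete_iff (hD : D ⊆ Finset.range (d + k + 1)) :
    (cyclicWord d k).Sublist (cyclicWordDelete d (d + k + 1) D) ↔
      ∃ i ≤ k, D ⊆ Finset.Icc i (i + d) := by
  constructor
  · intro h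
    obtain ⟨E, hDE, hE, heq⟩ := exists_eq_cyclicWordDelete hD h
    have hlen : (complList (d + k + 1) E).length = k := by
      have := congrArg List.length heq
      simpa [cyclicWord, cyclicWordDelete, eq_comm] using this
    have hcard := length_complList hE
    -- Here `|E| = d + 1`, so the `j`-th survivor lies in `[j, j + d + 1]` and is congruent to `j`:
    -- only the two ends remain.
    have key : ∀ j (hj : j < (complList (d + k + 1) E).length), (complList (d + k + 1) E)[j] = j ∨
        (complList (d + k + 1) E)[j] = j + (d + 1) := by
      intro j hj
      have h1 := le_getElem_complList hj
      have h2 := getElem_complList_le hE hj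
      have hmod : Fin.ofNat (d + 1) j = Fin.ofNat (d + 1) (complList (d + k + 1) E)[j] := by
        have := List.getElem_of_eq heq (i := j) (by simpa [cyclicWord] using hlen ▸ hj)
        simpa only [cyclicWordDelete, cyclicWord, List.getElem_map, List.getElem_range] using this
      rcases h1.lt_or_eq with h1 | h1
      · exact Or.inr (eq_add_of_ofNat_eq h1 (by omega) hmod)
      · exact Or.inl h1.symm
    -- Positions increase strictly, so once a survivor is shifted by a period all later ones are.
    -- The first shifted index `i` (or `k` if there is none) starts the deleted window.
    obtain ⟨i, hik, hlt, hge⟩ : ∃ i ≤ k,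
        (∀ j (hj : j < (complList (d + k + 1) E).length), j < i →
          (complList (d + k + 1) E)[j] = j) ∧
        ∀ j (hj : j < (complList (d + k + 1) E).length), i ≤ j →
          (complList (d + k + 1) E)[j] = j + (d + 1) := by
      by_cases hex : ∃ j, ∃ hj : j < (complList (d + k + 1) E).length,
          (complList (d + k + 1) E)[j] = j + (d + 1)
      · classical
        obtain ⟨hi, hi'⟩ := Nat.find_spec hex
        refine ⟨Nat.find hex, by omega, fun j hj hji => ?_, fun j hj hij => ?_⟩
        · exact (key j hj).resolve_right fun h => Nat.find_min hex hji ⟨hj, h⟩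
        · have := sortedLT_complList.getElem_add_le hij hj
          rcases key j hj with h | h <;> omega
      · refine ⟨k, le_rfl, fun j hj _ => (key j hj).resolve_right fun h => hex ⟨j, hj, h⟩,
          fun j hj hkj => by omega⟩
    refine ⟨i, hik, fun p hp => ?_⟩
    have hpE := hDE hp
    have hpN := Finset.mem_range.1 (hE hpE)
    have hmem : ∀ j (hj : j < (complList (d + k + 1) E).length),
        (complList (d + k + 1) E)[j] ≠ p := fun j hj h =>
      (mem_complList.1 (h ▸ List.getElem_mem hj)).2 hpE
    rw [Finset.mem_Icc]
    by_contra hcon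
    by_cases hpi : p < i
    · exact hmem p (by omega) (hlt p (by omega) hpi)
    · refine hmem (p - (d + 1)) (by omega) ?_
      rw [hge _ (by omega) (by omega)]
      omega
  · rintro ⟨i, hi, h⟩
    rw [← cyclicWordDelete_Icc hi]
    exact (complList_sublist h).map _

/-- Equal neighbours come from consecutive survivors exactly one period apart; the `d` positions
between them are deleted and, by `|D| ≤ d`, exhaust `D`. -/
lemma isChain_cyclicWordDelete_iff (hD : D ⊆ Finset.range (d + k + 1)) (hcard : D.card ≤ d) :
    (cyclicWordDelete d (d + k + 1) D).IsChain (· ≠ ·) ↔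
      ∀ i < k, D ≠ Finset.Icc (i + 1) (i + d) := by
  rw [cyclicWordDelete, List.isChain_map]
  constructor
  · rintro h i hi rfl
    -- Displays the adjacent survivors `i` and `i + (d + 1)`, which carry the same letter.
    have hsplit : complList (d + k + 1) (Finset.Icc (i + 1) (i + d)) =
        List.range i ++ i :: (i + (d + 1)) ::
          (List.range (k - i - 1)).map (· + (i + (d + 1) + 1)) := by
      refine sortedLT_complList.eq_of_mem_iff (List.Pairwise.sortedLT ?_) fun p => ?_
      · simp only [List.pairwise_append, List.pairwise_lt_range, List.pairwise_cons,
          List.pairwise_map, List.mem_cons, List.mem_map, List.mem_range, true_and]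
        refine ⟨⟨?_, ?_, ?_⟩, ?_⟩
        · rintro a (rfl | ⟨b, -, rfl⟩) <;> omega
        · rintro a ⟨b, -, rfl⟩; omega
        · exact List.pairwise_lt_range.imp fun {a b} h => by omega
        · rintro a ha b (rfl | rfl | ⟨c, -, rfl⟩) <;> omega
      · simp only [mem_complList, Finset.mem_Icc, List.mem_append, List.mem_cons, List.mem_map,
          List.mem_range]
        constructor
        · rintro ⟨h1, h2⟩
          by_cases h3 : p ≤ i
          · omega
          · by_cases h4 : p = i + (d + 1)
            · omega
            · exact Or.inr (Or.inr (Or.inr ⟨p - (i + (d + 1) + 1), by omega, by omega⟩))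
        · rintro (h | h | h | ⟨b, hb, rfl⟩) <;> omega
    rw [hsplit, List.isChain_iff_forall_rel_of_append_cons_cons] at h
    exact h rfl (by simp [Fin.ofNat])
  · intro h
    rw [List.isChain_iff_getElem]
    intro j hj heq
    have h1 : (complList (d + k + 1) D)[j] < (complList (d + k + 1) D)[j + 1] :=
      sortedLT_complList.getElem_lt_getElem_iff.2 (Nat.lt_succ_self j)
    have h2 := le_getElem_complList (N := d + k + 1) (D := D) (j := j) (by omega)
    have h3 := getElem_complList_le hD hj
    have h4 := eq_add_of_ofNat_eq h1 (by omega) heq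
    have h5 := (mem_complList.1 (List.getElem_mem hj)).1
    have hsub : Finset.Icc ((complList (d + k + 1) D)[j] + 1) ((complList (d + k + 1) D)[j] + d) ⊆
        D := by
      intro p hp
      rw [Finset.mem_Icc] at hp
      by_contra hpD
      obtain ⟨m, hm, rfl⟩ := List.mem_iff_getElem.1
        (mem_complList.2 ⟨by omega, hpD⟩ : p ∈ complList (d + k + 1) D)
      have h6 : j < m := sortedLT_complList.getElem_lt_getElem_iff.1
        (show (complList (d + k + 1) D)[j] < (complList (d + k + 1) D)[m] by omega)
      have h7 : m < j + 1 := sortedLT_complList.getElem_lt_getElem_iff.1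
        (show (complList (d + k + 1) D)[m] < (complList (d + k + 1) D)[j + 1] by omega)
      omega
    refine h _ ?_ (Finset.eq_of_subset_of_card_le hsub ?_).symm
    · omega
    · rwa [card_Icc_succ_add]

end CyclicWord

/-! ### The Bruhat interval and the conclusion -/

namespace CoxeterSystem

open ConvexPolytope

variable {d k : ℕ} {W : Type*} [Group W]

lemma isChain_cyclicWord_add (h : d ≠ 0 ∨ k = 0) :
    (cyclicWord d (d + k + 1)).IsChain (· ≠ ·) := by
  rw [← cyclicWordDelete_empty, isChain_cyclicWordDelete_iff (by simp) (by simp)]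
  exact (empty_mem_stackedComplex h).2.2

lemma isChain_cyclicWord (h : d ≠ 0 ∨ k = 0) : (cyclicWord d k).IsChain (· ≠ ·) := by
  have hk : cyclicWord d k <+: cyclicWord d (d + k + 1) := by
    refine List.IsPrefix.map _ ?_
    rw [show d + k + 1 = k + (d + 1) by omega, List.range_add]
    exact List.prefix_append _ _
  exact (isChain_cyclicWord_add h).prefix hk

/-- Apart from its minimum, the elements of the interval between the products of two cyclic words
correspond to the faces of a stacked complex. -/
theorem nonempty_orderIso_bruhatInterval (h : d ≠ 0 ∨ k = 0)
    (cs : CoxeterSystem (universalCoxeterMatrix (Fin (d + 1))) W) :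
    Nonempty (WithBot (stackedComplex d k)ᵒᵈ ≃o
      cs.BruhatInterval (cs.wordProd (cyclicWord d k))
        (cs.wordProd (cyclicWord d (d + k + 1)))) := by
  have hk := isChain_cyclicWord h
  have hN := isChain_cyclicWord_add h
  have hkN : (cyclicWord d k).Sublist (cyclicWord d (d + k + 1)) :=
    (List.range_sublist.2 (by omega)).map _
  have hchain : ∀ D ∈ stackedComplex d k,
      (cyclicWordDelete d (d + k + 1) D).IsChain (· ≠ ·) := fun D hD =>
    (isChain_cyclicWordDelete_iff (subset_range_of_mem_stackedComplex hD) hD.2.1).2 hD.2.2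
  have hlow : ∀ D ∈ stackedComplex d k,
      (cyclicWord d k).Sublist (cyclicWordDelete d (d + k + 1) D) := fun D hD =>
    (cyclicWord_sublist_cyclicWordDelete_iff (subset_range_of_mem_stackedComplex hD)).2 hD.1
  let g : WithBot (stackedComplex d k)ᵒᵈ → cs.BruhatInterval (cs.wordProd (cyclicWord d k))
      (cs.wordProd (cyclicWord d (d + k + 1))) :=
    WithBot.recBotCoe
      ⟨cs.wordProd (cyclicWord d k), (cs.bruhatLE_wordProd_iff hk hk).2 (List.Sublist.refl _),
        (cs.bruhatLE_wordProd_iff hk hN).2 hkN⟩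
      fun D => ⟨cs.wordProd (cyclicWordDelete d (d + k + 1) (OrderDual.ofDual D).1),
        (cs.bruhatLE_wordProd_iff hk (hchain _ (OrderDual.ofDual D).2)).2
          (hlow _ (OrderDual.ofDual D).2),
        (cs.bruhatLE_wordProd_iff (hchain _ (OrderDual.ofDual D).2) hN).2 (by
          rw [← cyclicWordDelete_empty]
          exact (complList_sublist (Finset.empty_subset _)).map _)⟩
  have hg : ∀ D D', g D ≤ g D' ↔ D ≤ D' := by
    intro D D'
    induction D using WithBot.recBotCoe with
    | bot => exact iff_of_true (g D').2.1 bot_le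
    | coe D =>
      have hD := (OrderDual.ofDual D).2
      have hDN := subset_range_of_mem_stackedComplex hD
      induction D' using WithBot.recBotCoe with
      | bot =>
        refine iff_of_false (fun h => ?_) (WithBot.not_coe_le_bot D)
        -- At most `d` deletions leave at least `k + 1` letters, too many for a subword of `C_k`.
        have h := ((cs.bruhatLE_wordProd_iff (hchain _ hD) hk).1 h).length_le
        have h1 := length_cyclicWordDelete (d := d) hDN
        have h2 := hD.2.1
        rw [show (cyclicWord d k).length = k by simp [cyclicWord]] at h
        omega
      | coe D' =>
        have hD' := (OrderDual.ofDual D').2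
        rw [WithBot.coe_le_coe]
        exact (cs.bruhatLE_wordProd_iff (hchain _ hD) (hchain _ hD')).trans
          (cyclicWordDelete_sublist_iff hDN (subset_range_of_mem_stackedComplex hD') hD.2.1)
  have hinj : Function.Injective g := fun D D' hDD' =>
    le_antisymm ((hg D D').1 (hDD' ▸ (hg D D).2 le_rfl))
      ((hg D' D).1 (hDD' ▸ (hg D D).2 le_rfl))
  refine ⟨RelIso.ofSurjective (⟨⟨g, hinj⟩, hg _ _⟩ :
    RelEmbedding (α := WithBot (stackedComplex d k)ᵒᵈ) (· ≤ ·) (· ≤ ·)) ?_⟩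
  rintro ⟨w, hw⟩
  obtain ⟨ω, hω, rfl⟩ := cs.exists_isReduced w
  have hω1 := (cs.bruhatLE_wordProd_iff hk hω.isChain).1 hw.1
  have hω2 := (cs.bruhatLE_wordProd_iff hω.isChain hN).1 hw.2
  rw [← cyclicWordDelete_empty] at hω2
  obtain ⟨D, -, hDN, rfl⟩ := exists_eq_cyclicWordDelete (by simp) hω2
  have hwin := (cyclicWord_sublist_cyclicWordDelete_iff hDN).1 hω1
  -- More than `d` deletions inside a window delete the whole window, which gives the minimum `C_k`.
  by_cases hcard : D.card ≤ d
  · exact ⟨WithBot.some (OrderDual.toDual ⟨D, hwin, hcard,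
      (isChain_cyclicWordDelete_iff hDN hcard).1 hω.isChain⟩), rfl⟩
  · obtain ⟨i, hi, hDi⟩ := hwin
    have hDeq : D = Finset.Icc i (i + d) :=
      Finset.eq_of_subset_of_card_le hDi (by rw [Nat.card_Icc]; omega)
    refine ⟨⊥, Subtype.ext ?_⟩
    change cs.wordProd (cyclicWord d k) = cs.wordProd (cyclicWordDelete d (d + k + 1) D)
    rw [hDeq, cyclicWordDelete_Icc hi]

end CoxeterSystem

theorem mainTheorem7 (d k : ℕ) (hdk : 2 ≤ d ∨ k = 0) {W : Type*} [Group W]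
    (cs : CoxeterSystem (universalCoxeterMatrix (Fin (d + 1))) W) :
    ∃ P : Set (EuclideanSpace ℝ (Fin d)),
      ConvexPolytope.IsDualStacked P ∧
      ConvexPolytope.dim P = d ∧
      (ConvexPolytope.facets P).ncard = d + k + 1 ∧
      Nonempty (cs.BruhatInterval (cs.wordProd (cyclicWord d k))
        (cs.wordProd (cyclicWord d (d + k + 1))) ≃o ConvexPolytope.FaceLattice P) := by
  have h : d ≠ 0 ∨ k = 0 := by omega
  obtain ⟨s, hP, -, hT, -⟩ := ConvexPolytope.exists_dualStacked_polyhedron h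
  have h0 : ∅ ∈ ConvexPolytope.activeSets (d + k + 1) s :=
    hT ▸ ConvexPolytope.empty_mem_stackedComplex h
  refine ⟨ConvexPolytope.polyhedron (d + k + 1) s, hP, ConvexPolytope.dim_polyhedron h0, ?_, ?_⟩
  -- A point has a single facet, the empty face, of dimension `-1`; it is not cut out by a singleton
  -- active set.
  · rcases eq_or_ne d 0 with rfl | hd
    · obtain rfl : k = 0 := by omega
      rw [ConvexPolytope.facets_eq_of_dim_eq_zero (ConvexPolytope.dim_polyhedron h0)]
      simp
    · exact ConvexPolytope.ncard_facets_polyhedron hd h0 fun i hi =>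
        hT ▸ ConvexPolytope.singleton_mem_stackedComplex (by omega) hi
  · obtain ⟨e⟩ := cs.nonempty_orderIso_bruhatInterval h
    obtain ⟨e'⟩ := ConvexPolytope.nonempty_orderIso_faceLattice (N := d + k + 1) (s := s)
    rw [hT] at e'
    exact ⟨e.symm.trans e'⟩
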